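/- Let $G=(V,E)$ be a finite connected plane geometric graph: the vertices are distinct points of $\mathbb{R}^2$, the edges are straight-line segments between vertices, and distinct edges (and vertices) meet only in common endpoints. Let $\mathcal{G}\subset\mathbb{R}^2$ be the associated continuous geometric graph, i.e. the set of all vertices and all points of edges. For points $p,q\in\mathcal{G}$, a $pq$-path in $\mathcal{G}$ consists of consecutive edges of $G$ together with at most two fragments of edges at its ends (or of a single fragment of one edge); its length is the sum of the Euclidean lengths of its parts, and $d_{\mathcal{G}}(p,q)$ is the length of a shortest $pq$-path. A pair $p,q\in\mathcal{G}$ is diametral if $d_{\mathcal{G}}(p,q)=\max_{x,y\in\mathcal{G}}d_{\mathcal{G}}(x,y)$, and its diametral set $D_{\mathcal{G}}(p,q)$ is the union of all shortest $pq$-paths in $\mathcal{G}$. Let $p,q$ and $p',q'$ be two diametral pairs of $\mathcal{G}$, and let $\mathcal{G}(pq,p'q')$ be any continuous subgraph of $\mathcal{G}$ that contains, for each of the six pairs $i\neq j$ in $\{p,q,p',q'\}$, a shortest $ij$-path of $\mathcal{G}$ (a continuous subgraph is a continuous geometric graph contained in $\mathcal{G}$ as a set of points; its vertices may subdivide edges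 of $G$). If $D_{\mathcal{G}}(p,q)\cap D_{\mathcal{G}}(p',q')=\emptyset$, then for every planar embedding $\varphi$ of $\mathcal{G}(pq,p'q')$ (a topological embedding of this set of points into $\mathbb{R}^2$), there is no face, i.e. no connected component of $\mathbb{R}^2\setminus\varphi(\mathcal{G}(pq,p'q'))$, whose boundary contains all four points $\varphi(p),\varphi(q),\varphi(p'),\varphi(q')$. -/

import Mathlib

noncomputable section

namespace BorsukGraph

/-- The Euclidean plane. -/
abbrev Plane := EuclideanSpace ℝ (Fin 2)

/-- A plane geometric graph: vertices are distinct points of the plane, edges are straight-line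
segments, and two edges meet at most in a common endpoint. -/
structure GeometricGraph (V : Type*) where
  /-- the underlying abstract graph -/
  graph : SimpleGraph V
  /-- the position of a vertex -/
  pos : V → Plane
  pos_injective : Function.Injective pos
  vertex_notMem_edge : ∀ u v w, graph.Adj u v → pos w ∉ openSegment ℝ (pos u) (pos v)
  edges_disjoint : ∀ u v u' v', graph.Adj u v → graph.Adj u' v' → s(u, v) ≠ s(u', v') →
    Disjoint (openSegment ℝ (pos u) (pos v)) (openSegment ℝ (pos u') (pos v'))

namespace GeometricGraph

variable {V : Type*} (G : GeometricGraph V)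

/-- The continuous geometric graph of `G`, as a set of points of the plane: all vertices and all
points of edges. -/
def carrier : Set Plane :=
  {x | (∃ v, x = G.pos v) ∨
    ∃ u v, G.graph.Adj u v ∧ x ∈ segment ℝ (G.pos u) (G.pos v)}

/-- The point `x` is the vertex `u`, or lies on an edge with endpoint `u`; so the segment from `x`
to `u` is a (possibly degenerate) fragment of an edge at `u`. -/
def IsFragment (x : Plane) (u : V) : Prop :=
  x = G.pos u ∨ ∃ v, G.graph.Adj u v ∧ x ∈ segment ℝ (G.pos u) (G.pos v)

/-- The `pq`-paths in the continuous geometric graph: either a fragment of one edge that contains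
both `p` and `q`, or a sequence of edges of the graph preceded and followed by a fragment of an
edge. -/
inductive CPath (p q : Plane) : Type _ where
  | direct (u v : V) (huv : G.graph.Adj u v)
      (hp : p ∈ segment ℝ (G.pos u) (G.pos v)) (hq : q ∈ segment ℝ (G.pos u) (G.pos v)) :
      CPath p q
  | through (u v : V) (hp : G.IsFragment p u) (w : G.graph.Walk u v) (hq : G.IsFragment q v) :
      CPath p q

variable {G}

/-- The length of a path: the sum of the Euclidean lengths of its edges and fragments. -/
def CPath.length {p q : Plane} : G.CPath p q → ℝ
  | .direct _ _ _ _ _ => dist p q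
  | .through u v _ w _ =>
      dist p (G.pos u) + (w.darts.map fun d => dist (G.pos d.fst) (G.pos d.snd)).sum
        + dist (G.pos v) q

/-- The set of points of a path. -/
def CPath.support {p q : Plane} : G.CPath p q → Set Plane
  | .direct _ _ _ _ _ => segment ℝ p q
  | .through u v _ w _ =>
      segment ℝ p (G.pos u) ∪ (⋃ d ∈ w.darts, segment ℝ (G.pos d.fst) (G.pos d.snd))
        ∪ segment ℝ (G.pos v) q

/-- A path is shortest if no path with the same endpoints is shorter. -/
def CPath.IsShortest {p q : Plane} (P : G.CPath p q) : Prop :=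
  ∀ Q : G.CPath p q, P.length ≤ Q.length

variable (G)

/-- The distance of two points in the continuous geometric graph. -/
def cdist (p q : Plane) : ℝ :=
  ⨅ P : G.CPath p q, P.length

/-- `p, q` are a diametral pair: two points of the continuous graph whose distance is the maximum
(the diameter) of the distances between points of the continuous graph. -/
def IsDiametralPair (p q : Plane) : Prop :=
  p ∈ G.carrier ∧ q ∈ G.carrier ∧
    IsGreatest {r | ∃ x ∈ G.carrier, ∃ y ∈ G.carrier, r = G.cdist x y} (G.cdist p q)

/-- The diametral set of `p, q`: the union of all shortest `pq`-paths. -/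
def diametralSet (p q : Plane) : Set Plane :=
  ⋃ (P : G.CPath p q) (_ : P.IsShortest), P.support

/-- `H` is a choice of the subgraph `𝒢(pq, p'q')`: a continuous subgraph of `G` (its vertices may
subdivide edges of `G`) that contains, for any two of the four points, a path between them that is
shortest in `G`. -/
def IsSelectedSubgraph {W : Type*} (H : GeometricGraph W) (p q p' q' : Plane) : Prop :=
  H.carrier ⊆ G.carrier ∧
    ∀ x ∈ ({p, q, p', q'} : Set Plane), ∀ y ∈ ({p, q, p', q'} : Set Plane), x ≠ y →
      ∃ P : G.CPath x y, P.IsShortest ∧ P.support ⊆ H.carrier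

/-- `φ` restricts to a planar embedding of the continuous graph: a homeomorphism of its set of
points onto a subset of the plane. (The values of `φ` elsewhere are irrelevant.) -/
def IsPlanarEmbedding (φ : Plane → Plane) : Prop :=
  Topology.IsEmbedding (G.carrier.domRestrict φ)

end GeometricGraph

/-- `F` is a face of the drawing `X`: a connected component of the complement of `X`. -/
def IsFace (X F : Set Plane) : Prop :=
  ∃ x ∈ Xᶜ, F = connectedComponentIn Xᶜ x

end BorsukGraph

end

/-! If all four points lay on the boundary of one face, a fifth point inside that face could be
joined to each of them. Together with the images of the six selected shortest paths this draws `K₅`,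
and edges without a common vertex turn out to be disjoint, which `exists_independent_edges_meet`
forbids. Edges with a common vertex may meet arbitrarily, so shortest paths that share stretches do
no harm.

The disjointness is an exchange argument. Let `D` be the diameter. The `pq`-path and the `p'q'`-path
are disjoint by hypothesis. If a `pp'`-path and a `qq'`-path, each of length at most `D`, met at
`c`, their four pieces could be regrouped into a `pq`-path and a `p'q'`-path via `c` of total length
at most `2D`. Both would then be shortest, so `c` would lie in both diametral sets
(`mem_diametralSet_of_length_le`). The pairs `pq'`, `qp'` behave alike.

The statement about `K₅` is a parity count: winding data of disjoint edges around each other's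
endpoints satisfy fifteen integer relations whose sum is contradictory mod 2. -/

noncomputable section

namespace BorsukGraph

/-! ### Continuous logarithms along paths -/

open Complex in
/-- The increment of a continuous logarithm of `z - c` along a path does not depend on the choice
of the logarithm, nor on a constant nonzero factor. -/
theorem exists_logIncrement {a b : ℂ} (γ : Path a b) (c : ℂ) :
    ∃ δ : ℂ, ∀ ε : ℂ, ε ≠ 0 → ∀ ℓ : unitInterval → ℂ, Continuous ℓ →
      (∀ s, exp (ℓ s) = ε * (γ s - c)) → ℓ 1 - ℓ 0 = δ := by
  by_cases h : ∃ ε : ℂ, ε ≠ 0 ∧ ∃ ℓ : unitInterval → ℂ, Continuous ℓ ∧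
      ∀ s, exp (ℓ s) = ε * (γ s - c)
  · obtain ⟨ε₀, hε₀, ℓ₀, hℓ₀, h₀⟩ := h
    refine ⟨ℓ₀ 1 - ℓ₀ 0, fun ε hε ℓ hℓ h => ?_⟩
    have hquot : ∀ s, exp (ℓ s - ℓ₀ s) = ε / ε₀ := fun s => by
      have hs : γ s - c ≠ 0 := fun h' => exp_ne_zero (ℓ s) (by rw [h s, h', mul_zero])
      rw [exp_sub, h s, h₀ s, mul_div_mul_right _ _ hs]
    -- The difference of the two logarithms lifts a constant through the covering `exp`, so it is
    -- constant.
    have := isCoveringMap_exp.const_of_comp (g := fun s => ℓ s - ℓ₀ s) (hℓ.sub hℓ₀)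
      (fun s t => Subtype.ext ((hquot s).trans (hquot t).symm)) 1 0
    linear_combination this
  · push Not at h
    exact ⟨0, fun ε hε ℓ hℓ h' => absurd h' (not_forall.2 (h ε hε ℓ hℓ))⟩

/-- The increment of a continuous logarithm of `z - c` as `z` runs along the path `γ`. -/
def logIncrement {a b : ℂ} (γ : Path a b) (c : ℂ) : ℂ :=
  (exists_logIncrement γ c).choose

theorem logIncrement_eq {a b : ℂ} (γ : Path a b) (c : ℂ) {ε : ℂ} (hε : ε ≠ 0)
    {ℓ : unitInterval → ℂ} (hℓ : Continuous ℓ)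
    (h : ∀ s, Complex.exp (ℓ s) = ε * (γ s - c)) : logIncrement γ c = ℓ 1 - ℓ 0 :=
  ((exists_logIncrement γ c).choose_spec ε hε ℓ hℓ h).symm

/-- A nowhere vanishing continuous function on the square has a continuous logarithm. -/
theorem exists_continuous_log_square (f : C(unitInterval × unitInterval, ℂ)) (hf : ∀ x, f x ≠ 0) :
    ∃ g : C(unitInterval × unitInterval, ℂ), ∀ x, Complex.exp (g x) = f x := by
  -- Clamping both coordinates extends `f` to the simply connected plane, where the lifting theorem
  -- applies.
  have hcont : Continuous fun x : ℝ × ℝ =>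
      f (Set.projIcc 0 1 zero_le_one x.1, Set.projIcc 0 1 zero_le_one x.2) :=
    f.continuous.comp ((continuous_projIcc.comp continuous_fst).prodMk
      (continuous_projIcc.comp continuous_snd))
  obtain ⟨g, ⟨-, hg⟩, -⟩ := Complex.isCoveringMapOn_exp.existsUnique_continuousMap_lifts
    (f := ⟨_, hcont⟩) (a₀ := (0, 0)) (e₀ := Complex.log (f (0, 0)))
    (by simp [Complex.exp_log (hf _), Set.projIcc_left]) (fun x => hf _)
  refine ⟨⟨fun x => g (x.1, x.2), by fun_prop⟩, fun x => ?_⟩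
  have := congrFun hg ((x.1 : ℝ), (x.2 : ℝ))
  simpa using this

/-- Around the square of two disjoint paths, the logarithm of their difference has no monodromy. -/
theorem logIncrement_square {a b c d : ℂ} (γ : Path a b) (δ : Path c d)
    (h : ∀ s t, γ s ≠ δ t) :
    logIncrement γ c + logIncrement δ b = logIncrement γ d + logIncrement δ a ∧
      Complex.exp (logIncrement γ c) * (a - c) = b - c ∧
      Complex.exp (logIncrement γ d) * (a - d) = b - d ∧
      Complex.exp (logIncrement δ a) * (c - a) = d - a ∧
      Complex.exp (logIncrement δ b) * (c - b) = d - b := by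
  -- The four increments are those of one logarithm of `γ s - δ t` along the sides of the square. On
  -- the sides where `δ` moves, the sign is reversed, whence the factor `-1`.
  obtain ⟨g, hg⟩ := exists_continuous_log_square
    ⟨fun x => γ x.1 - δ x.2, by fun_prop⟩ (fun x => sub_ne_zero.2 (h x.1 x.2))
  have hg' : ∀ s t, Complex.exp (g (s, t)) = γ s - δ t := fun s t => hg (s, t)
  have h1 : logIncrement γ c = g (1, 0) - g (0, 0) :=
    logIncrement_eq γ c one_ne_zero (ℓ := fun s => g (s, 0)) (by fun_prop)
      (fun s => by simp [hg'])
  have h2 : logIncrement γ d = g (1, 1) - g (0, 1) :=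
    logIncrement_eq γ d one_ne_zero (ℓ := fun s => g (s, 1)) (by fun_prop)
      (fun s => by simp [hg'])
  have h3 : logIncrement δ a = g (0, 1) - g (0, 0) :=
    logIncrement_eq δ a (neg_ne_zero.2 one_ne_zero) (ℓ := fun s => g (0, s)) (by fun_prop)
      (fun s => by simp [hg'])
  have h4 : logIncrement δ b = g (1, 1) - g (1, 0) :=
    logIncrement_eq δ b (neg_ne_zero.2 one_ne_zero) (ℓ := fun s => g (1, s)) (by fun_prop)
      (fun s => by simp [hg'])
  have e1 : a - c ≠ 0 := sub_ne_zero.2 (by simpa using h 0 0)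
  have e2 : a - d ≠ 0 := sub_ne_zero.2 (by simpa using h 0 1)
  have e3 : b - c ≠ 0 := sub_ne_zero.2 (by simpa using h 1 0)
  have e1' : c - a ≠ 0 := sub_ne_zero.2 (by simpa using (h 0 0).symm)
  have e3' : c - b ≠ 0 := sub_ne_zero.2 (by simpa using (h 1 0).symm)
  rw [h1, h2, h3, h4]
  refine ⟨by ring, ?_, ?_, ?_, ?_⟩ <;> rw [Complex.exp_sub, hg', hg'] <;>
    simp only [Path.source, Path.target] <;> field_simp <;> ring

/-! ### Independent edges of a drawing of `K₅` -/

/-- The complete graph on five vertices has no drawing in the plane in which any two edges without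
common vertex are disjoint. -/
theorem exists_independent_edges_meet (P : Fin 5 → ℂ) (γ : ∀ i j, Path (P i) (P j)) :
    ∃ i j k l, i < j ∧ k < l ∧ i ≠ k ∧ i ≠ l ∧ j ≠ k ∧ j ≠ l ∧ ∃ s t, γ i j s = γ k l t := by
  by_contra! hcon
  -- Any two vertices are ends of two disjoint edges `ik` and `jl`, which do not meet.
  have hne : ∀ i j, i < j → P i ≠ P j := by
    intro i j hij he
    have key : ∀ i j : Fin 5, i < j → ∃ k l, i ≠ k ∧ i ≠ l ∧ j ≠ k ∧ j ≠ l ∧ k ≠ l := by decide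
    obtain ⟨k, l, h1, h2, h3, h4, h5⟩ := key i j hij
    rcases lt_or_gt_of_ne h1 with hik | hik <;> rcases lt_or_gt_of_ne h4 with hjl | hjl
    · exact hcon i k j l hik hjl hij.ne h2 h3.symm h5 0 0 (by simpa using he)
    · exact hcon i k l j hik hjl h2 hij.ne h5 h3.symm 0 1 (by simpa using he)
    · exact hcon k i j l hik hjl h3.symm h5 hij.ne h2 1 0 (by simpa using he)
    · exact hcon k i l j hik hjl h5 h3.symm h2 hij.ne 1 1 (by simpa using he)
  -- Fixed logarithms of `P i - P j`, chosen so that swapping the indices changes them by exactly `±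
  -- π i`; `σ` records the sign.
  set τ : Fin 5 → Fin 5 → ℂ := fun i j =>
    if i < j then Complex.log (P i - P j) else Complex.log (P j - P i) + Real.pi * Complex.I with hτ
  set σ : Fin 5 → Fin 5 → ℤ := fun i j => if i < j then -1 else 1 with hσ
  have hexp : ∀ i j, i ≠ j → Complex.exp (τ i j) = P i - P j := by
    intro i j hij
    rcases lt_or_gt_of_ne hij with h | h
    · simp only [hτ, h, if_true]
      exact Complex.exp_log (sub_ne_zero.2 (hne i j h))
    · simp only [hτ, h.not_gt, if_false]
      rw [Complex.exp_add, Complex.exp_pi_mul_I, Complex.exp_log (sub_ne_zero.2 (hne j i h))]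
      ring
  have hanti : ∀ i j, i ≠ j → τ i j - τ j i = σ i j * (Real.pi * Complex.I) := by
    intro i j hij
    rcases lt_or_gt_of_ne hij with h | h
    · simp [hτ, hσ, h, h.not_gt]
    · simp [hτ, hσ, h, h.not_gt]
  have hn : ∀ i j k, ∃ n : ℤ, k ≠ i → k ≠ j →
      Complex.exp (logIncrement (γ i j) (P k)) * (P i - P k) = P j - P k →
      logIncrement (γ i j) (P k) = τ j k - τ i k + n * (2 * Real.pi * Complex.I) := by
    intro i j k
    by_cases h : k ≠ i ∧ k ≠ j ∧
      Complex.exp (logIncrement (γ i j) (P k)) * (P i - P k) = P j - P k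
    · obtain ⟨hi, hj, h⟩ := h
      rw [← hexp i k hi.symm, ← hexp j k hj.symm, ← Complex.exp_add,
        Complex.exp_eq_exp_iff_exists_int] at h
      obtain ⟨n, hn⟩ := h
      exact ⟨n, fun _ _ _ => by linear_combination hn⟩
    · exact ⟨0, fun h1 h2 h3 => absurd ⟨h1, h2, h3⟩ h⟩
  choose n hn using hn
  -- The monodromy identity of the square of the edges `ij` and `kl`, divided by `π i`.
  have hrel : ∀ i j k l, i < j → k < l → i ≠ k → i ≠ l → j ≠ k → j ≠ l →
      2 * (n i j k + n k l j - n i j l - n k l i) + (σ j k - σ i k + σ l j + σ i l) = 0 := by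
    intro i j k l hij hkl hik hil hjk hjl
    obtain ⟨h0, h1, h2, h3, h4⟩ := logIncrement_square (γ i j) (γ k l)
      (hcon i j k l hij hkl hik hil hjk hjl)
    rw [hn i j k hik.symm hjk.symm h1, hn i j l hil.symm hjl.symm h2,
      hn k l i hik hil h3, hn k l j hjk hjl h4] at h0
    have hpi : (Real.pi : ℂ) * Complex.I ≠ 0 :=
      mul_ne_zero (Complex.ofReal_ne_zero.2 Real.pi_ne_zero) Complex.I_ne_zero
    have : ((2 * (n i j k + n k l j - n i j l - n k l i)
        + (σ j k - σ i k + σ l j + σ i l) : ℤ) : ℂ) * (Real.pi * Complex.I) = 0 := by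
      push_cast
      linear_combination h0 - hanti j k hjk + hanti i k hik - hanti l j hjl.symm - hanti i l hil
    exact_mod_cast (mul_eq_zero.1 this).resolve_right hpi
  -- All fifteen pairs of disjoint edges.
  have e1 := hrel 0 1 2 3 (by decide) (by decide) (by decide) (by decide) (by decide) (by decide)
  have e2 := hrel 0 2 1 3 (by decide) (by decide) (by decide) (by decide) (by decide) (by decide)
  have e3 := hrel 0 3 1 2 (by decide) (by decide) (by decide) (by decide) (by decide) (by decide)
  have e4 := hrel 0 1 2 4 (by decide) (by decide) (by decide) (by decide) (by decide) (by decide)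
  have e5 := hrel 0 2 1 4 (by decide) (by decide) (by decide) (by decide) (by decide) (by decide)
  have e6 := hrel 0 4 1 2 (by decide) (by decide) (by decide) (by decide) (by decide) (by decide)
  have e7 := hrel 0 1 3 4 (by decide) (by decide) (by decide) (by decide) (by decide) (by decide)
  have e8 := hrel 0 3 1 4 (by decide) (by decide) (by decide) (by decide) (by decide) (by decide)
  have e9 := hrel 0 4 1 3 (by decide) (by decide) (by decide) (by decide) (by decide) (by decide)
  have e10 := hrel 0 2 3 4 (by decide) (by decide) (by decide) (by decide) (by decide) (by decide)
  have e11 := hrel 0 3 2 4 (by decide) (by decide) (by decide) (by decide) (by decide) (by decide)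
  have e12 := hrel 0 4 2 3 (by decide) (by decide) (by decide) (by decide) (by decide) (by decide)
  have e13 := hrel 1 2 3 4 (by decide) (by decide) (by decide) (by decide) (by decide) (by decide)
  have e14 := hrel 1 3 2 4 (by decide) (by decide) (by decide) (by decide) (by decide) (by decide)
  have e15 := hrel 1 4 2 3 (by decide) (by decide) (by decide) (by decide) (by decide) (by decide)
  have hlt : ∀ i j : Fin 5, i < j → σ i j = -1 := fun i j h => if_pos h
  have hgt : ∀ i j : Fin 5, ¬ i < j → σ i j = 1 := fun i j h => if_neg h
  rw [hgt 2 1 (by decide), hgt 3 1 (by decide), hgt 4 1 (by decide), hgt 3 2 (by decide),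
    hgt 4 2 (by decide), hgt 4 3 (by decide), hlt 0 1 (by decide), hlt 0 2 (by decide),
    hlt 0 3 (by decide), hlt 0 4 (by decide), hlt 1 2 (by decide), hlt 1 3 (by decide),
    hlt 1 4 (by decide), hlt 2 3 (by decide), hlt 2 4 (by decide), hlt 3 4 (by decide)] at *
  -- Halve the relations and add them mod 2. Each integer `n i j k` occurs twice, once for either
  -- choice of the second end of the edge at `k`, so these cancel. The half-sum of signs is odd
  -- exactly when the pairs interlace, as in `0 2 | 1 3`; this happens once for every four vertices,
  -- that is, five times.
  omega

/-! ### Lengths and supports of walks and paths -/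

namespace GeometricGraph

variable {V : Type*} {G : GeometricGraph V}

/-- The total Euclidean length of a walk. -/
def walkLength {u v : V} (w : G.graph.Walk u v) : ℝ :=
  (w.darts.map fun d => dist (G.pos d.fst) (G.pos d.snd)).sum

theorem walkLength_nil (u : V) : walkLength (SimpleGraph.Walk.nil : G.graph.Walk u u) = 0 := by
  simp [walkLength]

theorem walkLength_cons {u v z : V} (h : G.graph.Adj u v) (w : G.graph.Walk v z) :
    walkLength (w.cons h) = dist (G.pos u) (G.pos v) + walkLength w := by
  simp [walkLength]

theorem walkLength_append {u v z : V} (w : G.graph.Walk u v) (w' : G.graph.Walk v z) :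
    walkLength (w.append w') = walkLength w + walkLength w' := by
  simp [walkLength, SimpleGraph.Walk.darts_append]

theorem walkLength_reverse {u v : V} (w : G.graph.Walk u v) :
    walkLength w.reverse = walkLength w := by
  simp [walkLength, SimpleGraph.Walk.darts_reverse, Function.comp_def, dist_comm]

theorem dist_le_walkLength {u v : V} (w : G.graph.Walk u v) :
    dist (G.pos u) (G.pos v) ≤ walkLength w := by
  induction w with
  | nil => simp [walkLength_nil]
  | cons h w ih => exact (dist_triangle _ _ _).trans (by rw [walkLength_cons]; gcongr)

theorem exists_walk_split {u v : V} (w : G.graph.Walk u v) {d : G.graph.Dart} (hd : d ∈ w.darts) :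
    ∃ (w₁ : G.graph.Walk u d.fst) (w₂ : G.graph.Walk d.snd v),
      walkLength w = walkLength w₁ + dist (G.pos d.fst) (G.pos d.snd) + walkLength w₂ := by
  induction w with
  | nil => simp at hd
  | cons h w ih =>
    rcases List.mem_cons.1 (by simpa using hd) with rfl | hd
    · exact ⟨.nil, w, by simp [walkLength_cons, walkLength_nil]⟩
    · obtain ⟨w₁, w₂, hw⟩ := ih hd
      exact ⟨w₁.cons h, w₂, by rw [walkLength_cons, walkLength_cons, hw]; ring⟩

/-- The set of points of the edges of a walk. -/
def walkSupport {u v : V} (w : G.graph.Walk u v) : Set Plane :=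
  ⋃ d ∈ w.darts, segment ℝ (G.pos d.fst) (G.pos d.snd)

theorem segment_subset_walkSupport {u v : V} {w : G.graph.Walk u v} {d : G.graph.Dart}
    (hd : d ∈ w.darts) : segment ℝ (G.pos d.fst) (G.pos d.snd) ⊆ walkSupport w :=
  fun _ hx => Set.mem_iUnion₂.2 ⟨d, hd, hx⟩

theorem joinedIn_segment (x y : Plane) : JoinedIn (segment ℝ x y) x y :=
  ((convex_segment x y).isPathConnected ⟨x, left_mem_segment ℝ x y⟩).joinedIn x
    (left_mem_segment ℝ x y) y (right_mem_segment ℝ x y)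

theorem joinedIn_insert_walkSupport {u v : V} (w : G.graph.Walk u v) :
    JoinedIn (insert (G.pos u) (walkSupport w)) (G.pos u) (G.pos v) := by
  induction w with
  | nil => exact JoinedIn.refl (Set.mem_insert _ _)
  | @cons a b c h w ih =>
    have h1 : segment ℝ (G.pos a) (G.pos b) ⊆ walkSupport (w.cons h) :=
      segment_subset_walkSupport (d := ⟨(a, b), h⟩) (by simp)
    have h2 : walkSupport w ⊆ walkSupport (w.cons h) :=
      Set.iUnion₂_subset fun d hd => segment_subset_walkSupport (by simp [hd])
    refine ((joinedIn_segment _ _).mono (h1.trans (Set.subset_insert _ _))).trans (ih.mono ?_)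
    exact Set.insert_subset (Or.inr (h1 (right_mem_segment ℝ _ _)))
      (h2.trans (Set.subset_insert _ _))

theorem isFragment_pos (u : V) : G.IsFragment (G.pos u) u := Or.inl rfl

theorem isFragment_of_mem_segment {u v : V} (h : G.graph.Adj u v) {x : Plane}
    (hx : x ∈ segment ℝ (G.pos u) (G.pos v)) : G.IsFragment x u := Or.inr ⟨v, h, hx⟩

namespace CPath

variable {x y c : Plane}

theorem length_direct {u v : V} (huv : G.graph.Adj u v) (hp) (hq) :
    (CPath.direct u v huv hp hq : G.CPath x y).length = dist x y := rfl

theorem length_through {u v : V} (hp) (w : G.graph.Walk u v) (hq) :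
    (CPath.through u v hp w hq : G.CPath x y).length =
      dist x (G.pos u) + walkLength w + dist (G.pos v) y := rfl

theorem support_direct {u v : V} (huv : G.graph.Adj u v) (hp) (hq) :
    (CPath.direct u v huv hp hq : G.CPath x y).support = segment ℝ x y := rfl

theorem support_through {u v : V} (hp) (w : G.graph.Walk u v) (hq) :
    (CPath.through u v hp w hq : G.CPath x y).support =
      segment ℝ x (G.pos u) ∪ walkSupport w ∪ segment ℝ (G.pos v) y := rfl

theorem joinedIn_support (P : G.CPath x y) : JoinedIn P.support x y := by
  cases P with
  | direct u v huv hp hq => exact joinedIn_segment x y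
  | through u v hp w hq =>
    rw [support_through]
    refine (((joinedIn_segment x (G.pos u)).mono ?_).trans
      ((joinedIn_insert_walkSupport w).mono ?_)).trans ((joinedIn_segment (G.pos v) y).mono ?_)
    · exact fun z hz => Or.inl (Or.inl hz)
    · exact Set.insert_subset (Or.inl (Or.inl (right_mem_segment ℝ _ _)))
        fun z hz => Or.inl (Or.inr hz)
    · exact fun z hz => Or.inr hz

theorem dist_le_length (P : G.CPath x y) : dist x y ≤ P.length := by
  cases P with
  | direct u v huv hp hq => exact le_rfl
  | through u v hp w hq =>
    rw [length_through]
    linarith [dist_triangle4 x (G.pos u) (G.pos v) y, dist_le_walkLength w]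

theorem length_nonneg (P : G.CPath x y) : 0 ≤ P.length :=
  dist_nonneg.trans P.dist_le_length

theorem cdist_le (P : G.CPath x y) : G.cdist x y ≤ P.length :=
  ciInf_le ⟨0, by rintro _ ⟨Q, rfl⟩; exact Q.length_nonneg⟩ P

theorem IsShortest.length_eq {P : G.CPath x y} (hP : P.IsShortest) : P.length = G.cdist x y :=
  haveI : Nonempty (G.CPath x y) := ⟨P⟩
  le_antisymm (le_ciInf hP) P.cdist_le

theorem IsShortest.of_length_le {P : G.CPath x y} (hP : P.length ≤ G.cdist x y) :
    P.IsShortest := fun Q => hP.trans Q.cdist_le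

theorem IsShortest.support_subset {P : G.CPath x y} (hP : P.IsShortest) :
    P.support ⊆ G.diametralSet x y :=
  Set.subset_iUnion₂_of_subset P hP subset_rfl

/-- Every path can be traversed backwards. -/
theorem exists_reverse (P : G.CPath x y) :
    ∃ Q : G.CPath y x, Q.length = P.length := by
  cases P with
  | direct u v huv hp hq => exact ⟨.direct u v huv hq hp, dist_comm _ _⟩
  | through u v hp w hq =>
    refine ⟨.through v u hq w.reverse hp, ?_⟩
    rw [length_through, length_through, walkLength_reverse, dist_comm y, dist_comm _ x]
    ring

theorem exists_refl (hx : x ∈ G.carrier) : ∃ P : G.CPath x x, P.length = 0 ∧ x ∈ P.support := by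
  rcases hx with ⟨v, rfl⟩ | ⟨u, v, huv, hx⟩
  · refine ⟨.through v v (isFragment_pos v) .nil (isFragment_pos v), ?_, ?_⟩
    · simp [length_through, walkLength_nil]
    · exact Or.inr (left_mem_segment ℝ _ _)
  · exact ⟨.direct u v huv hx hx, dist_self x, left_mem_segment ℝ _ _⟩

end CPath

/-! ### Splitting and concatenating paths -/

theorem IsFragment.of_segment {x c : Plane} {u : V} (hx : G.IsFragment x u)
    (hc : c ∈ segment ℝ x (G.pos u)) : G.IsFragment c u := by
  rcases hx with rfl | ⟨v, huv, hx⟩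
  · exact Or.inl (by simpa using hc)
  · exact Or.inr ⟨v, huv, (convex_segment _ _).segment_subset hx (left_mem_segment ℝ _ _) hc⟩

theorem IsFragment.exists_cpath {x c : Plane} {u : V} (hx : G.IsFragment x u)
    (hc : c ∈ segment ℝ x (G.pos u)) : ∃ P : G.CPath x c, P.length = dist x c := by
  rcases hx with rfl | ⟨v, huv, hx⟩
  · obtain rfl : c = G.pos u := by simpa using hc
    exact ⟨.through u u (isFragment_pos u) .nil (isFragment_pos u), by
      simp [CPath.length_through, walkLength_nil]⟩
  · exact ⟨.direct u v huv hx
      ((convex_segment _ _).segment_subset hx (left_mem_segment ℝ _ _) hc), rfl⟩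

/-- A point of a path splits it into two paths. -/
theorem CPath.exists_split {x y c : Plane} (P : G.CPath x y) (hc : c ∈ P.support) :
    ∃ (A : G.CPath x c) (B : G.CPath c y), A.length + B.length = P.length := by
  cases P with
  | direct u v huv hp hq =>
    have hc' : c ∈ segment ℝ (G.pos u) (G.pos v) := (convex_segment _ _).segment_subset hp hq hc
    exact ⟨.direct u v huv hp hc', .direct u v huv hc' hq, dist_add_dist_of_mem_segment hc⟩
  | through u v hp w hq =>
    rw [support_through] at hc
    rcases hc with (hc | hc) | hc
    · obtain ⟨A, hA⟩ := hp.exists_cpath hc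
      refine ⟨A, .through u v (hp.of_segment hc) w hq, ?_⟩
      rw [hA, length_through, length_through, ← dist_add_dist_of_mem_segment hc]
      ring
    · obtain ⟨d, hd, hc⟩ := Set.mem_iUnion₂.1 hc
      obtain ⟨w₁, w₂, hw⟩ := exists_walk_split w hd
      refine ⟨.through u d.fst hp w₁ (isFragment_of_mem_segment d.adj hc),
        .through d.snd v (isFragment_of_mem_segment d.adj.symm (by rwa [segment_symm])) w₂ hq, ?_⟩
      rw [length_through, length_through, length_through, hw, ← dist_add_dist_of_mem_segment hc]
      ring
    · rw [segment_symm] at hc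
      obtain ⟨B, hB⟩ := hq.exists_cpath hc
      obtain ⟨B', hB'⟩ := B.exists_reverse
      refine ⟨.through u v hp w (hq.of_segment hc), B', ?_⟩
      rw [hB', hB, length_through, length_through, dist_comm _ y,
        ← dist_add_dist_of_mem_segment hc, dist_comm _ c]
      ring

theorem eq_or_eq_of_pos_mem_segment {u v z : V} (huv : G.graph.Adj u v)
    (hz : G.pos z ∈ segment ℝ (G.pos u) (G.pos v)) : z = u ∨ z = v := by
  rw [← insert_endpoints_openSegment] at hz
  rcases hz with h | h | h
  · exact Or.inl (G.pos_injective h)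
  · exact Or.inr (G.pos_injective h)
  · exact absurd h (G.vertex_notMem_edge u v z huv)

/-- Away from the vertices a point is interior to each edge containing it, and interiors of distinct
edges are disjoint. -/
theorem edge_eq_of_mem_segment {u v u' v' : V} {c : Plane} (hc : ∀ z, c ≠ G.pos z)
    (huv : G.graph.Adj u v) (huv' : G.graph.Adj u' v')
    (h : c ∈ segment ℝ (G.pos u) (G.pos v)) (h' : c ∈ segment ℝ (G.pos u') (G.pos v')) :
    s(u, v) = s(u', v') := by
  by_contra hne
  refine Set.disjoint_left.1 (G.edges_disjoint u v u' v' huv huv' hne)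
    (mem_openSegment_of_ne_left_right (hc u).symm (hc v).symm h)
    (mem_openSegment_of_ne_left_right (hc u').symm (hc v').symm h')

namespace CPath

variable {a b c : Plane}

/-- A path that ends at a vertex is a fragment followed by a walk to this vertex. -/
theorem exists_walk_of_target (z : V) (A : G.CPath a (G.pos z)) :
    ∃ (u : V) (_ : G.IsFragment a u) (w : G.graph.Walk u z),
      dist a (G.pos u) + walkLength w ≤ A.length := by
  cases A with
  | direct u v huv hp hq =>
    rcases eq_or_eq_of_pos_mem_segment huv hq with rfl | rfl
    · exact ⟨z, Or.inr ⟨v, huv, hp⟩, .nil, by simp [walkLength_nil, length_direct]⟩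
    · exact ⟨z, Or.inr ⟨u, huv.symm, by rwa [segment_symm]⟩, .nil,
        by simp [walkLength_nil, length_direct]⟩
  | through u v hp w hq =>
    have hq' := hq
    rcases hq' with h | ⟨v', hv, h⟩
    · obtain rfl := G.pos_injective h
      exact ⟨u, hp, w, by simp [length_through]⟩
    · rcases eq_or_eq_of_pos_mem_segment hv h with rfl | rfl
      · exact ⟨u, hp, w, by simp [length_through]⟩
      · refine ⟨u, hp, w.append (.cons hv .nil), ?_⟩
        rw [walkLength_append, walkLength_cons, walkLength_nil, length_through]
        linarith

theorem exists_trans_vertex (z : V) (A : G.CPath a (G.pos z)) (B : G.CPath (G.pos z) b) :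
    ∃ C : G.CPath a b, C.length ≤ A.length + B.length ∧ G.pos z ∈ C.support := by
  obtain ⟨u, hu, w, hw⟩ := A.exists_walk_of_target
  obtain ⟨B', hB'⟩ := B.exists_reverse
  obtain ⟨v, hv, w', hw'⟩ := B'.exists_walk_of_target
  refine ⟨.through u v hu (w.append w'.reverse) hv, ?_, ?_⟩
  · rw [length_through, walkLength_append, walkLength_reverse, dist_comm _ b]
    linarith
  · rw [support_through]
    -- The vertex `z` is the start of the first edge of the second walk or, if that walk is empty,
    -- of the final fragment.
    generalize w'.reverse = w''
    cases w'' with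
    | nil => exact Or.inr (left_mem_segment ℝ _ _)
    | @cons _ z' _ h w'' =>
      refine Or.inl (Or.inr (segment_subset_walkSupport (d := ⟨(z, z'), h⟩) ?_ (left_mem_segment ℝ _ _)))
      simp [SimpleGraph.Walk.darts_append]

theorem mem_segment_or_dist_lt (a b c : Plane) :
    c ∈ segment ℝ a b ∨ dist a b < dist a c + dist c b := by
  rcases (dist_triangle a c b).lt_or_eq with h | h
  · exact Or.inr h
  · exact Or.inl (mem_segment_iff_wbtw.2 (dist_add_dist_eq_iff.1 h.symm))

/-- A fragment of the edge through `c` followed by a path from `c` that leaves through an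
endpoint `v` of this edge. -/
theorem exists_trans_direct_through {v z v' : V} (hvz : G.graph.Adj v z)
    (ha : a ∈ segment ℝ (G.pos v) (G.pos z)) (w : G.graph.Walk v v') (hb : G.IsFragment b v') :
    ∃ C : G.CPath a b,
      (c ∈ C.support ∧
        C.length ≤ dist a c + (dist c (G.pos v) + walkLength w + dist (G.pos v') b)) ∨
      C.length < dist a c + (dist c (G.pos v) + walkLength w + dist (G.pos v') b) := by
  refine ⟨.through v v' (isFragment_of_mem_segment hvz ha) w hb, ?_⟩
  rw [length_through, support_through]
  rcases mem_segment_or_dist_lt a (G.pos v) c with h | h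
  · exact Or.inl ⟨Or.inl (Or.inl h), by linarith [dist_add_dist_of_mem_segment h]⟩
  · exact Or.inr (by linarith)

/-- Two paths can be concatenated; the result passes through the common endpoint unless it can be
made shorter. -/
theorem exists_trans (A : G.CPath a c) (B : G.CPath c b) :
    ∃ C : G.CPath a b, (c ∈ C.support ∧ C.length ≤ A.length + B.length) ∨
      C.length < A.length + B.length := by
  by_cases hc : ∃ z, c = G.pos z
  · obtain ⟨z, rfl⟩ := hc
    obtain ⟨C, h, h'⟩ := A.exists_trans_vertex z B
    exact ⟨C, Or.inl ⟨h', h⟩⟩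
  push Not at hc
  cases A with
  | direct s t hst ha hc₁ =>
    cases B with
    | direct s' t' hst' hc₂ hb =>
      have hb' : b ∈ segment ℝ (G.pos s) (G.pos t) := by
        rcases Sym2.eq_iff.1 (edge_eq_of_mem_segment hc hst hst' hc₁ hc₂) with
          ⟨rfl, rfl⟩ | ⟨rfl, rfl⟩
        · exact hb
        · rwa [segment_symm]
      refine ⟨.direct s t hst ha hb', ?_⟩
      rw [length_direct, length_direct, length_direct, support_direct]
      rcases mem_segment_or_dist_lt a b c with h | h
      · exact Or.inl ⟨h, (dist_add_dist_of_mem_segment h).ge⟩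
      · exact Or.inr h
    | through v v' hv w hb =>
      obtain ⟨z, hvz, hc₂⟩ := hv.resolve_left (hc v)
      refine exists_trans_direct_through hvz ?_ w hb
      rcases Sym2.eq_iff.1 (edge_eq_of_mem_segment hc hst hvz hc₁ hc₂) with
        ⟨rfl, rfl⟩ | ⟨rfl, rfl⟩
      · exact ha
      · rwa [segment_symm]
  | through u s hu w hs =>
    obtain ⟨t, hst, hc₁⟩ := hs.resolve_left (hc s)
    cases B with
    | direct s' t' hst' hc₂ hb =>
      have hb' : b ∈ segment ℝ (G.pos s) (G.pos t) := by
        rcases Sym2.eq_iff.1 (edge_eq_of_mem_segment hc hst hst' hc₁ hc₂) with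
          ⟨rfl, rfl⟩ | ⟨rfl, rfl⟩
        · exact hb
        · rwa [segment_symm]
      refine ⟨.through u s hu w (isFragment_of_mem_segment hst hb'), ?_⟩
      rw [length_through, length_through, length_direct, support_through]
      rcases mem_segment_or_dist_lt (G.pos s) b c with h | h
      · exact Or.inl ⟨Or.inr h, by linarith [dist_add_dist_of_mem_segment h]⟩
      · exact Or.inr (by linarith)
    | through v v' hv w' hb =>
      obtain ⟨z, hvz, hc₂⟩ := hv.resolve_left (hc v)
      rcases Sym2.eq_iff.1 (edge_eq_of_mem_segment hc hst hvz hc₁ hc₂) with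
        ⟨rfl, rfl⟩ | ⟨rfl, rfl⟩
      -- Arriving at `c` and leaving it through the same end of its edge: the detour to `c` is
      -- dropped, a strict gain.
      · refine ⟨.through u v' hu (w.append w') hb, Or.inr ?_⟩
        rw [length_through, length_through, length_through, walkLength_append]
        linarith [dist_pos.2 (hc s), dist_nonneg (x := G.pos s) (y := c)]
      -- Leaving through the opposite end: the two fragments make up the whole edge.
      · refine ⟨.through u v' hu (w.append (w'.cons hst)) hb, Or.inl ⟨?_, ?_⟩⟩
        · refine Or.inl (Or.inr (segment_subset_walkSupport (d := ⟨(s, t), hst⟩) ?_ hc₁))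
          simp [SimpleGraph.Walk.darts_append]
        · rw [length_through, length_through, length_through, walkLength_append, walkLength_cons]
          linarith [dist_add_dist_of_mem_segment hc₁]

end CPath

end GeometricGraph

/-! ### Four points on the boundary of a face -/

theorem exists_independent_sets_meet (P : Fin 5 → Plane) (S : Fin 5 → Fin 5 → Set Plane)
    (hS : ∀ i j, i < j → JoinedIn (S i j) (P i) (P j)) :
    ∃ i j k l, i < j ∧ k < l ∧ i ≠ k ∧ i ≠ l ∧ j ≠ k ∧ j ≠ l ∧ ¬ Disjoint (S i j) (S k l) := by
  have hγ : ∀ i j, ∃ γ : Path (P i) (P j), i < j → ∀ t, γ t ∈ S i j := fun i j => by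
    by_cases h : i < j
    · exact ⟨(hS i j h).somePath, fun _ => (hS i j h).somePath_mem⟩
    · exact ⟨(PathConnectedSpace.joined (P i) (P j)).somePath, fun h' => absurd h' h⟩
  choose γ hγ using hγ
  let e := Complex.orthonormalBasisOneI.repr.symm
  obtain ⟨i, j, k, l, hij, hkl, h1, h2, h3, h4, s, t, hst⟩ :=
    exists_independent_edges_meet (fun i => e (P i)) (fun i j => (γ i j).map e.continuous)
  refine ⟨i, j, k, l, hij, hkl, h1, h2, h3, h4, Set.not_disjoint_iff.2
    ⟨γ i j s, hγ i j hij s, ?_⟩⟩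
  rw [e.injective hst]
  exact hγ k l hkl t

theorem exists_isCompact_joinedIn {S : Set Plane} {x y : Plane} (h : JoinedIn S x y) :
    ∃ C ⊆ S, IsCompact C ∧ JoinedIn C x y :=
  ⟨Set.range h.somePath, Set.range_subset_iff.2 h.somePath_mem,
    isCompact_range h.somePath.continuous, h.somePath, Set.mem_range_self⟩

/-- Four points on the boundary of a face of `X` cannot be pairwise joined in `X` in such a way that
no connection meets a disjoint one or a third point. -/
theorem IsFace.not_complete {X F : Set Plane} (hX : IsClosed X) (hF : IsFace X F)
    (z : Fin 4 → Plane) (hz : ∀ i, z i ∈ closure F) (S : Fin 4 → Fin 4 → Set Plane)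
    (hSX : ∀ i j, i < j → S i j ⊆ X) (hS : ∀ i j, i < j → JoinedIn (S i j) (z i) (z j))
    (hzS : ∀ i j k, i < j → k ≠ i → k ≠ j → z k ∉ S i j)
    (hdisj : ∀ i j k l, i < j → k < l → i ≠ k → i ≠ l → j ≠ k → j ≠ l →
      Disjoint (S i j) (S k l)) : False := by
  obtain ⟨x, hx, rfl⟩ := hF
  have hFX := connectedComponentIn_subset Xᶜ x
  have hxF := mem_connectedComponentIn hx
  have hopen : IsOpen (connectedComponentIn Xᶜ x) := hX.isOpen_compl.connectedComponentIn
  have hpath : IsPathConnected (connectedComponentIn Xᶜ x) :=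
    hopen.isConnected_iff_isPathConnected.1 (isConnected_connectedComponentIn_iff.2 hx)
  set F := connectedComponentIn Xᶜ x
  -- Compact connections keep a positive distance from points off them.
  have hC : ∀ i j, ∃ C : Set Plane, IsCompact C ∧
      (i < j → C ⊆ S i j ∧ JoinedIn C (z i) (z j)) := fun i j => by
    by_cases h : i < j
    · obtain ⟨C, h1, h2, h3⟩ := exists_isCompact_joinedIn (hS i j h)
      exact ⟨C, h2, fun _ => ⟨h1, h3⟩⟩
    · exact ⟨∅, isCompact_empty, fun h' => absurd h' h⟩
  choose C hCc hC using hC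
  -- A boundary point need not be accessible along an arc in `F`. It suffices to enter `F` within a
  -- small ball around `z k`: the ball may cross connections ending at `z k`, but avoids all others.
  have hT : ∀ k, ∃ T : Set Plane, JoinedIn T (z k) x ∧
      ∀ i j, i < j → k ≠ i → k ≠ j → Disjoint T (C i j) := fun k => by
    let K : Set Plane := ⋃ i, ⋃ j, ⋃ (_ : i < j ∧ k ≠ i ∧ k ≠ j), C i j
    have hK : IsCompact K := isCompact_iUnion fun i => isCompact_iUnion fun j =>
      isCompact_iUnion fun _ => hCc i j
    have hkK : z k ∈ Kᶜ := by
      simp only [K, Set.mem_compl_iff, Set.mem_iUnion, not_exists]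
      exact fun i j h hk => hzS i j k h.1 h.2.1 h.2.2 ((hC i j h.1).1 hk)
    obtain ⟨ε, hε, hball⟩ := Metric.isOpen_iff.1 hK.isClosed.isOpen_compl _ hkK
    obtain ⟨y, hyF, hy⟩ := Metric.mem_closure_iff.1 (hz k) ε hε
    refine ⟨Metric.ball (z k) ε ∪ F, ?_, fun i j hij hi hj => ?_⟩
    · refine JoinedIn.trans (y := y) (JoinedIn.mono ?_ Set.subset_union_left)
        ((hpath.joinedIn y hyF x hxF).mono Set.subset_union_right)
      exact ((convex_ball (z k) ε).isPathConnected ⟨z k, Metric.mem_ball_self hε⟩).joinedIn _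
        (Metric.mem_ball_self hε) _ (by rwa [Metric.mem_ball'])
    · refine Set.disjoint_left.2 fun w hw hwC => ?_
      rcases hw with hw | hw
      · exact hball hw (Set.mem_iUnion.2 ⟨i, Set.mem_iUnion.2 ⟨j, Set.mem_iUnion.2
          ⟨⟨hij, hi, hj⟩, hwC⟩⟩⟩)
      · exact hFX hw (hSX i j hij ((hC i j hij).1 hwC))
  choose T hTj hT using hT
  -- The fifth vertex `x` gets the last index and the sets `T i` become its edges; the entries `∅`
  -- have first index last, so they are never used.
  let P : Fin 5 → Plane := Fin.snoc (α := fun _ => Plane) z x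
  let E : Fin 5 → Fin 5 → Set Plane := fun i =>
    Fin.snoc (α := fun _ => Set Plane)
      (fun j => Fin.snoc (α := fun _ => Set Plane) (fun i' => C i' j) ∅ i)
      (Fin.snoc (α := fun _ => Set Plane) T ∅ i)
  have hP : ∀ i : Fin 4, P i.castSucc = z i := fun i =>
    Fin.snoc_castSucc (α := fun _ => Plane) ..
  have hPl : P (Fin.last 4) = x := Fin.snoc_last (α := fun _ => Plane) ..
  have hE : ∀ i j : Fin 4, E i.castSucc j.castSucc = C i j := fun i j => by simp [E]
  have hEl : ∀ i : Fin 4, E i.castSucc (Fin.last 4) = T i := fun i =>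
    (Fin.snoc_last (α := fun _ => Set Plane) ..).trans
      (Fin.snoc_castSucc (α := fun _ => Set Plane) ..)
  have hcast : ∀ i j : Fin 5, i < j → ∃ i' : Fin 4, i = i'.castSucc := fun i j h =>
    ⟨i.castPred (Fin.ne_last_of_lt h), by simp⟩
  obtain ⟨i, j, k, l, hij, hkl, h1, h2, h3, h4, hmeet⟩ := exists_independent_sets_meet P E
    (fun i j hij => by
      obtain ⟨i, rfl⟩ := hcast i j hij
      induction j using Fin.lastCases with
      | last => rw [hP, hPl, hEl]; exact hTj i
      | cast j => rw [hP, hP, hE]; exact (hC i j (by simpa using hij)).2)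
  obtain ⟨i, rfl⟩ := hcast i j hij
  obtain ⟨k, rfl⟩ := hcast k l hkl
  apply hmeet
  induction j using Fin.lastCases with
  | last =>
    induction l using Fin.lastCases with
    | last => exact absurd rfl h4
    | cast l =>
      rw [hEl, hE]
      exact hT i k l (by simpa using hkl) (by simpa using h1) (by simpa using h2)
  | cast j =>
    have hij' : i < j := by simpa using hij
    induction l using Fin.lastCases with
    | last =>
      rw [hEl, hE]
      exact (hT k i j hij' (by simpa using h1.symm) (by simpa using h3.symm)).symm
    | cast l =>
      have hkl' : k < l := by simpa using hkl
      rw [hE, hE]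
      exact (hdisj i j k l hij' hkl' (by simpa using h1) (by simpa using h2) (by simpa using h3)
        (by simpa using h4)).mono (hC i j hij').1 (hC k l hkl').1

/-! ### The exchange argument for lengths -/

namespace GeometricGraph

variable {V : Type*} {G : GeometricGraph V}

theorem isCompact_carrier [Finite V] (G : GeometricGraph V) : IsCompact G.carrier := by
  have : G.carrier = Set.range G.pos ∪
      ⋃ u, ⋃ v, ⋃ (_ : G.graph.Adj u v), segment ℝ (G.pos u) (G.pos v) := by
    ext x
    simp [carrier, eq_comm]
  rw [this]
  refine (Set.finite_range _).isCompact.union (isCompact_iUnion fun u => isCompact_iUnion fun v =>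
    isCompact_iUnion fun _ => ?_)
  rw [← Path.range_segment]
  exact isCompact_range (Path.segment _ _).continuous

/-- If four paths to `c` from two pairs of points at distance at least `D` have total length at most
`2 * D`, then `c` lies on shortest paths of both pairs. -/
theorem mem_diametralSet_of_length_le {p q p' q' c : Plane} {D : ℝ}
    (hpq : G.cdist p q = D) (hpq' : G.cdist p' q' = D)
    (A : G.CPath p c) (B : G.CPath q c) (A' : G.CPath p' c) (B' : G.CPath q' c)
    (h : A.length + B.length + (A'.length + B'.length) ≤ 2 * D) :
    c ∈ G.diametralSet p q ∧ c ∈ G.diametralSet p' q' := by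
  obtain ⟨B₁, hB₁⟩ := B.exists_reverse
  obtain ⟨B₂, hB₂⟩ := B'.exists_reverse
  obtain ⟨C₁, hC₁⟩ := A.exists_trans B₁
  obtain ⟨C₂, hC₂⟩ := A'.exists_trans B₂
  have h₁ := C₁.cdist_le
  have h₂ := C₂.cdist_le
  rw [hB₁] at hC₁
  rw [hB₂] at hC₂
  -- Both new paths have length at least `D` and total at most `2 * D`, so a strict gain is
  -- impossible and both are shortest.
  rcases hC₁ with ⟨hc₁, hl₁⟩ | hl₁ <;> rcases hC₂ with ⟨hc₂, hl₂⟩ | hl₂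
  · exact ⟨(CPath.IsShortest.of_length_le (P := C₁) (by linarith)).support_subset hc₁,
      (CPath.IsShortest.of_length_le (P := C₂) (by linarith)).support_subset hc₂⟩
  all_goals linarith

/-- The piece between `a` and `c` already uses up the length `D`, leaving nothing between `c` and
`b`. -/
theorem CPath.eq_target_of_le {a b c : Plane} {D : ℝ} (P : G.CPath a b) (hP : P.length ≤ D)
    (hc : c ∈ P.support) (h : ∀ Q : G.CPath c a, D ≤ Q.length) : c = b := by
  obtain ⟨A, B, hAB⟩ := P.exists_split hc
  obtain ⟨A', hA'⟩ := A.exists_reverse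
  exact dist_le_zero.1 (by linarith [h A', B.dist_le_length])

theorem CPath.eq_source_of_le {a b c : Plane} {D : ℝ} (P : G.CPath a b) (hP : P.length ≤ D)
    (hc : c ∈ P.support) (h : ∀ Q : G.CPath c b, D ≤ Q.length) : c = a := by
  obtain ⟨A, B, hAB⟩ := P.exists_split hc
  exact (dist_le_zero.1 (by linarith [h B, A.dist_le_length])).symm

theorem mem_diametralSet_self {x : Plane} (hx : x ∈ G.carrier) : x ∈ G.diametralSet x x := by
  obtain ⟨P, h0, hP⟩ := CPath.exists_refl hx
  have : P.IsShortest := fun Q => h0.le.trans Q.length_nonneg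
  exact this.support_subset hP

theorem CPath.IsShortest.endpoints_mem {x y : Plane} {P : G.CPath x y} (hP : P.IsShortest) :
    x ∈ G.diametralSet x y ∧ y ∈ G.diametralSet x y :=
  ⟨hP.support_subset P.joinedIn_support.source_mem, hP.support_subset P.joinedIn_support.target_mem⟩

end GeometricGraph

end BorsukGraph

end

/-! ### The four diametral points -/

open BorsukGraph in
theorem mainTheorem12 {V W : Type*} [Finite V] [Finite W]
    (G : GeometricGraph V) (hG : G.graph.Connected)
    (p q p' q' : Plane)
    (hpq : G.IsDiametralPair p q) (hpq' : G.IsDiametralPair p' q')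
    (hdisj : Disjoint (G.diametralSet p q) (G.diametralSet p' q'))
    (H : GeometricGraph W) (hH : G.IsSelectedSubgraph H p q p' q')
    (φ : Plane → Plane) (hφ : H.IsPlanarEmbedding φ) :
    ¬ ∃ F : Set Plane, IsFace (φ '' H.carrier) F ∧
        φ p ∈ frontier F ∧ φ q ∈ frontier F ∧ φ p' ∈ frontier F ∧ φ q' ∈ frontier F := by
  rintro ⟨F, hF, hp, hq, hp', hq'⟩
  have hcont : ContinuousOn φ H.carrier := continuousOn_iff_continuous_domRestrict.2 hφ.continuous
  have hinj : Set.InjOn φ H.carrier := Set.injOn_iff_injective.2 hφ.injective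
  set D := G.cdist p q with hD
  have hD' : G.cdist p' q' = D :=
    le_antisymm (hpq.2.2.2 ⟨p', hpq'.1, q', hpq'.2.1, rfl⟩)
      (hpq'.2.2.2 ⟨p, hpq.1, q, hpq.2.1, rfl⟩)
  have hmax : ∀ x ∈ G.carrier, ∀ y ∈ G.carrier, G.cdist x y ≤ D := fun x hx y hy =>
    hpq.2.2.2 ⟨x, hx, y, hy, rfl⟩
  let z : Fin 4 → Plane := ![p, q, p', q']
  have hzc : ∀ i, z i ∈ G.carrier := by
    intro i
    fin_cases i
    exacts [hpq.1, hpq.2.1, hpq'.1, hpq'.2.1]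
  have hzs : ∀ i, z i ∈ ({p, q, p', q'} : Set Plane) := by
    intro i
    fin_cases i <;> simp [z]
  -- The points are not yet known to be distinct, and `hH` gives paths only between distinct ones;
  -- coincident points use a path of length zero.
  have hmem : ∀ i j, z i ∈ G.diametralSet (z i) (z j) ∧ z j ∈ G.diametralSet (z i) (z j) := by
    intro i j
    by_cases h : z i = z j
    · rw [← h]
      exact ⟨GeometricGraph.mem_diametralSet_self (hzc i),
        GeometricGraph.mem_diametralSet_self (hzc i)⟩
    · obtain ⟨P, hP, -⟩ := hH.2 _ (hzs i) _ (hzs j) h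
      exact hP.endpoints_mem
  have hne : ∀ {a b}, a ∈ G.diametralSet p q → b ∈ G.diametralSet p' q' → a ≠ b :=
    fun ha hb h => Set.disjoint_left.1 hdisj ha (h ▸ hb)
  have hpp' : p ≠ p' := hne (hmem 0 1).1 (hmem 2 3).1
  have hpq'ne : p ≠ q' := hne (hmem 0 1).1 (hmem 2 3).2
  have hqp' : q ≠ p' := hne (hmem 0 1).2 (hmem 2 3).1
  have hqq' : q ≠ q' := hne (hmem 0 1).2 (hmem 2 3).2
  have hDpos : 0 < D := by
    obtain ⟨P, hP, -⟩ := hH.2 _ (hzs 0) _ (hzs 2) hpp'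
    have := hP.length_eq ▸ hmax _ (hzc 0) _ (hzc 2)
    exact (dist_pos.2 hpp').trans_le (P.dist_le_length.trans this)
  have hself : ∀ x ∈ G.carrier, G.cdist x x ≤ 0 := fun x hx => by
    obtain ⟨P, h0, -⟩ := GeometricGraph.CPath.exists_refl hx
    exact P.cdist_le.trans h0.le
  have hpqne : p ≠ q := by
    rintro rfl
    exact absurd (hself p hpq.1) (not_le.2 hDpos)
  have hpqne' : p' ≠ q' := by
    rintro rfl
    exact absurd (hself p' hpq'.1) (not_le.2 (hD' ▸ hDpos))
  have hz : ∀ i j, i < j → z i ≠ z j := by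
    intro i j hij
    fin_cases i <;> fin_cases j <;> first | exact absurd hij (by decide) | assumption
  have hz' : ∀ i j, i ≠ j → z i ≠ z j := fun i j h =>
    (lt_or_gt_of_ne h).elim (hz i j) fun h => (hz j i h).symm
  have hP : ∀ i j, i < j → ∃ P : G.CPath (z i) (z j), P.IsShortest ∧ P.support ⊆ H.carrier :=
    fun i j h => hH.2 _ (hzs i) _ (hzs j) (hz i j h)
  choose P hPs hPH using hP
  have hlen : ∀ i j h, (P i j h).length ≤ D := fun i j h =>
    (hPs i j h).length_eq.trans_le (hmax _ (hzc i) _ (hzc j))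
  -- The partner in the diametral pair.
  let mate : Fin 4 → Fin 4 := ![1, 0, 3, 2]
  have hfar : ∀ i, ∀ Q : G.CPath (z i) (z (mate i)), D ≤ Q.length := by
    have h1 : ∀ Q : G.CPath p q, D ≤ Q.length := fun Q => Q.cdist_le
    have h2 : ∀ Q : G.CPath p' q', D ≤ Q.length := fun Q => hD'.ge.trans Q.cdist_le
    intro i Q
    obtain ⟨Q', hQ'⟩ := Q.exists_reverse
    fin_cases i
    exacts [h1 Q, hQ' ▸ h1 Q', h2 Q, hQ' ▸ h2 Q']
  let S : Fin 4 → Fin 4 → Set Plane := fun i j => ⋃ h : i < j, φ '' (P i j h).support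
  have hSeq : ∀ i j (h : i < j), S i j = φ '' (P i j h).support := fun i j h => by simp [S, h]
  -- If an end of the path is the partner of `z k`, the distance `D` between them forces `z k` to be
  -- the other end. Otherwise the path joins the other diametral pair, and `z k` would lie in both
  -- diametral sets.
  have hsupp : ∀ i j k (h : i < j), k ≠ i → k ≠ j → z k ∉ (P i j h).support := by
    intro i j k h hki hkj hk
    by_cases h1 : mate k = i
    · subst h1
      exact hz' k j hkj ((P _ j h).eq_target_of_le (hlen _ j h) hk (hfar k))
    by_cases h2 : mate k = j
    · subst h2
      exact hz' k i hki ((P i _ h).eq_source_of_le (hlen i _ h) hk (hfar k))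
    have key : ∀ i j k : Fin 4, i < j → k ≠ i → k ≠ j → (![1, 0, 3, 2] : Fin 4 → Fin 4) k ≠ i →
        (![1, 0, 3, 2] : Fin 4 → Fin 4) k ≠ j →
        (i = 0 ∧ j = 1 ∧ (k = 2 ∨ k = 3)) ∨ (i = 2 ∧ j = 3 ∧ (k = 0 ∨ k = 1)) := by decide
    have hk' := (hPs i j h).support_subset hk
    rcases key i j k h hki hkj h1 h2 with ⟨rfl, rfl, rfl | rfl⟩ | ⟨rfl, rfl, rfl | rfl⟩
    · exact hne hk' (hmem 2 3).1 rfl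
    · exact hne hk' (hmem 2 3).2 rfl
    · exact hne (hmem 0 1).1 hk' rfl
    · exact hne (hmem 0 1).2 hk' rfl
  -- Of two disjoint pairs of indices one contains `0`; taking it as the first pair leaves the three
  -- perfect matchings.
  have hindep : ∀ i j k l (hij : i < j) (hkl : k < l), i = 0 → j ≠ k → j ≠ l → i ≠ k →
      ∀ c, c ∈ (P i j hij).support → c ∈ (P k l hkl).support → False := by
    intro i j k l hij hkl hi hjk hjl hik c hc hc'
    have key : ∀ i j k l : Fin 4, i < j → k < l → i = 0 → j ≠ k → j ≠ l → i ≠ k →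
        (i = 0 ∧ j = 1 ∧ k = 2 ∧ l = 3) ∨ (i = 0 ∧ j = 2 ∧ k = 1 ∧ l = 3) ∨
          (i = 0 ∧ j = 3 ∧ k = 1 ∧ l = 2) := by decide
    obtain ⟨A, B, hAB⟩ := (P i j hij).exists_split hc
    obtain ⟨A', B', hAB'⟩ := (P k l hkl).exists_split hc'
    obtain ⟨B₁, hB₁⟩ := B.exists_reverse
    obtain ⟨B₂, hB₂⟩ := B'.exists_reverse
    have hl := hlen i j hij
    have hl' := hlen k l hkl
    rcases key i j k l hij hkl hi hjk hjl hik with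
      ⟨rfl, rfl, rfl, rfl⟩ | ⟨rfl, rfl, rfl, rfl⟩ | ⟨rfl, rfl, rfl, rfl⟩
    · exact hne ((hPs _ _ hij).support_subset hc) ((hPs _ _ hkl).support_subset hc') rfl
    -- The pieces at `p` and `q` are put together, and so are those at `p'` and `q'`.
    · have hsum : A.length + A'.length + (B₁.length + B₂.length) ≤ 2 * D := by linarith
      have := GeometricGraph.mem_diametralSet_of_length_le hD.symm hD' A A' B₁ B₂ hsum
      exact hne this.1 this.2 rfl
    · have hsum : A.length + A'.length + (B₂.length + B₁.length) ≤ 2 * D := by linarith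
      have := GeometricGraph.mem_diametralSet_of_length_le hD.symm hD' A A' B₂ B₁ hsum
      exact hne this.1 this.2 rfl
  have himage : ∀ i j k l (hij : i < j) (hkl : k < l), i = 0 → j ≠ k → j ≠ l → i ≠ k →
      Disjoint (S i j) (S k l) := by
    intro i j k l hij hkl hi hjk hjl hik
    rw [hSeq i j hij, hSeq k l hkl]
    refine Set.disjoint_left.2 ?_
    rintro _ ⟨x, hx, rfl⟩ ⟨y, hy, hxy⟩
    obtain rfl := hinj (hPH _ _ _ hy) (hPH _ _ _ hx) hxy
    exact hindep i j k l hij hkl hi hjk hjl hik y hx hy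
  have hzH : ∀ k, z k ∈ H.carrier := by
    intro k
    fin_cases k
    · exact hPH 0 1 (by decide) (P 0 1 _).joinedIn_support.source_mem
    · exact hPH 0 1 (by decide) (P 0 1 _).joinedIn_support.target_mem
    · exact hPH 2 3 (by decide) (P 2 3 _).joinedIn_support.source_mem
    · exact hPH 2 3 (by decide) (P 2 3 _).joinedIn_support.target_mem
  refine hF.not_complete (H.isCompact_carrier.image_of_continuousOn hcont).isClosed
    (fun i => φ (z i)) ?_ S ?_ ?_ ?_ ?_
  · intro i
    fin_cases i
    exacts [frontier_subset_closure hp, frontier_subset_closure hq, frontier_subset_closure hp',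
      frontier_subset_closure hq']
  · intro i j h
    rw [hSeq i j h]
    exact Set.image_mono (hPH i j h)
  · intro i j h
    rw [hSeq i j h]
    exact (P i j h).joinedIn_support.map_continuousOn (hcont.mono (hPH i j h))
  · intro i j k h hki hkj hk
    rw [hSeq i j h] at hk
    obtain ⟨x, hx, hxk⟩ := hk
    exact hsupp i j k h hki hkj (hinj (hPH i j h hx) (hzH k) hxk ▸ hx)
  · intro i j k l hij hkl hik hil hjk hjl
    have key : ∀ i j k l : Fin 4, i < j → k < l → i ≠ k → i ≠ l → j ≠ k → j ≠ l →
        i = 0 ∨ k = 0 := by decide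
    rcases key i j k l hij hkl hik hil hjk hjl with h | h
    · exact himage i j k l hij hkl h hjk hjl hik
    · exact (himage k l i j hkl hij h hil.symm hjl.symm hik.symm).symm
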